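/- **Lemma 2.1.** Let $E$ be a real Banach space that is uniformly smooth, i.e. the limit $\lim_{t\to 0}\frac{\|x+ty\|-\|x\|}{t}$ exists for all $x,y$ in the unit sphere $U$ of $E$ and is attained uniformly for $(x,y)\in U\times U$. Let $D\subseteq E$ be nonempty, closed and convex, and let $T:D\to D$ be nonexpansive ($\|Tx-Ty\|\le\|x-y\|$ for all $x,y\in D$) with $F(T)=\{p\in D: Tp=p\}\neq\emptyset$. Let $\Pi_D$ be the set of all $g:D\to D$ for which there is $\alpha\in(0,1)$ with $\|g(x)-g(y)\|\le\alpha\|x-y\|$ for all $x,y\in D$. Let $f\in\Pi_D$ and $f_n\in\Pi_D$ $(n\ge 0)$ be such that $f_n\to f$ uniformly on $D$, and let $t_n\in(0,1)$ with $t_n\to 0$ as $n\to\infty$. Then: 1. for every $t\in(0,1)$ the equation $x=t f(x)+(1-t)Tx$ has a unique solution $x_t\in D$, and for every $n\ge 0$ the equation $z=t_n f_n(z)+(1-t_n)Tz$ has a unique solution $z_n\in D$; 2. the strong limit $Q(f):=\lim_{t\to 0^+}x_t$ exists and $Q(f)\in F(T)$; 3. $z_n\to Q(f)$ strongly as $n\to\infty$.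 -/

import Mathlib

open Filter Topology

/-- `E` is uniformly smooth: the limit of `(‖x + t y‖ - ‖x‖) / t` as `t → 0` exists for all `x, y` in
the unit sphere, and it is attained uniformly for `(x, y)` in the product of the sphere with itself. -/
def IsUniformlySmooth (E : Type*) [NormedAddCommGroup E] [NormedSpace ℝ E] : Prop :=
  ∃ G : E × E → ℝ,
    TendstoUniformlyOn (fun (t : ℝ) (p : E × E) => (‖p.1 + t • p.2‖ - ‖p.1‖) / t) G (𝓝[≠] 0)
      (Metric.sphere (0 : E) 1 ×ˢ Metric.sphere (0 : E) 1)

/-- The class `Π_D` of all contractions of `D` into itself. -/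
def contractionMaps {E : Type*} [NormedAddCommGroup E] (D : Set E) : Set (D → D) :=
  {f | ∃ α : ℝ, 0 < α ∧ α < 1 ∧ ∀ x y : D, ‖(f x : E) - f y‖ ≤ α * ‖(x : E) - y‖}

/-- `T` is nonexpansive on `D`. -/
def IsNonexpansive {E : Type*} [NormedAddCommGroup E] {D : Set E} (T : D → D) : Prop :=
  ∀ x y : D, ‖(T x : E) - T y‖ ≤ ‖(x : E) - y‖

/-- The point `x` of `D` solves the equation `x = t f(x) + (1 - t) T x`. -/
def IsViscositySolution {E : Type*} [NormedAddCommGroup E] [NormedSpace ℝ E] {D : Set E}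
    (T f : D → D) (t : ℝ) (x : D) : Prop :=
  (x : E) = t • (f x : E) + (1 - t) • (T x : E)

open Classical in
/-- The path `t ↦ x_t`, where `x_t` is the solution in `D` of `x = t f(x) + (1 - t) T x`
(with value `0` if there is no solution). -/
noncomputable def viscosityPath {E : Type*} [NormedAddCommGroup E] [NormedSpace ℝ E] {D : Set E}
    (T f : D → D) (t : ℝ) : E :=
  if h : ∃ x : D, IsViscositySolution T f t x then (h.choose : E) else 0

/-- `Q(f)`, the limit of `x_t` as `t → 0` (through positive `t`). -/
noncomputable def viscosityLimit {E : Type*} [NormedAddCommGroup E] [NormedSpace ℝ E] {D : Set E}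
    (T f : D → D) : E :=
  limUnder (𝓝[>] (0 : ℝ)) (viscosityPath T f)

/-! Let `q` be a fixed point of `T`, and test the equation for `x_s` with a norming functional `j`
of `x_s - q`. The nonexpansive part drops out and `(1 - α)‖x_s - q‖ ≤ j (f q - q)` remains. Uniform
smoothness bounds the norm to first order, so a small move from `q` towards `f q` lowers the
asymptotic distance to the path by a definite amount, unless that distance is already small. Let `γ`
be the infimum of the radii `c` for which some point of `D` is asymptotically within `c` of the
path. Each nonempty `asymptoticBall` is closed, convex, bounded and `T`-invariant, so it contains a
fixed point of `T`. If `γ > 0`, moving such a point beats `γ`; hence `γ = 0` and the path is Cauchy.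
The fixed points come from uniform normal structure: the dual is uniformly convex, which excludes
long almost diametral sequences, so bounded convex sets have good centers and nested invariant sets
shrink geometrically. Finally `z_n` is compared with `x_{t_n}`. -/

/-! ### Uniform smoothness and convexity of the dual -/

/-- The difference quotients at `t` and `-t` lie within `ε` of each other, and the one at `-t` is at
most `j y` because `j` norms `x`. -/
theorem IsUniformlySmooth.norm_add_le {E : Type*} [NormedAddCommGroup E] [NormedSpace ℝ E]
    (hE : IsUniformlySmooth E) {ε : ℝ} (hε : 0 < ε) :
    ∃ δ > 0, ∀ (x h : E) (j : E →L[ℝ] ℝ), ‖j‖ ≤ 1 → j x = ‖x‖ → ‖h‖ ≤ δ * ‖x‖ →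
      ‖x + h‖ ≤ ‖x‖ + j h + ε * ‖h‖ := by
  obtain ⟨G, hG⟩ := hE
  have h1 := Metric.tendstoUniformlyOn_iff.1 hG (ε / 2) (half_pos hε)
  rw [eventually_nhdsWithin_iff, Metric.eventually_nhds_iff] at h1
  obtain ⟨δ, hδ, H⟩ := h1
  have key : ∀ (x y : E) (t : ℝ) (j : E →L[ℝ] ℝ), ‖x‖ = 1 → ‖y‖ = 1 → 0 < t → t < δ → ‖j‖ ≤ 1 →
      j x = 1 → ‖x + t • y‖ ≤ 1 + t * j y + ε * t := by
    intro x y t j hx hy ht htδ hj hjx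
    have hmem : (x, y) ∈ Metric.sphere (0 : E) 1 ×ˢ Metric.sphere (0 : E) 1 := by
      simp [hx, hy]
    have a1 := H (y := t) (by simpa [abs_of_pos ht] using htδ) ht.ne' (x, y) hmem
    have a2 := H (y := -t) (by simpa [abs_of_pos ht] using htδ) (neg_ne_zero.2 ht.ne') (x, y) hmem
    rw [Real.dist_eq, abs_lt] at a1 a2
    simp only [hx] at a1 a2
    have b : 1 - t * j y ≤ ‖x + -t • y‖ := by
      have := j.le_of_opNorm_le hj (x + -t • y)
      have := (le_abs_self _).trans this
      simp only [map_add, map_smul, hjx, smul_eq_mul, one_mul] at this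
      linarith
    have c : (‖x + -t • y‖ - 1) / -t ≤ j y := by
      rw [div_neg, neg_le, le_div_iff₀ ht]
      linarith
    have d : (‖x + t • y‖ - 1) / t ≤ j y + ε := by linarith [a1.1, a1.2, a2.1, a2.2]
    rw [div_le_iff₀ ht] at d
    linarith
  refine ⟨δ / 2, half_pos hδ, fun x h j hj hjx hh => ?_⟩
  rcases eq_or_ne x 0 with rfl | hx
  · have : h = 0 := by simpa using hh
    simp [this]
  rcases eq_or_ne h 0 with rfl | hh0
  · simp
  have hxp := norm_pos_iff.2 hx
  have hhp := norm_pos_iff.2 hh0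
  have := key (‖x‖⁻¹ • x) (‖h‖⁻¹ • h) (‖h‖ / ‖x‖) j (by rw [norm_smul, norm_inv, norm_norm, inv_mul_cancel₀ hxp.ne'])
    (by rw [norm_smul, norm_inv, norm_norm, inv_mul_cancel₀ hhp.ne']) (by positivity)
    (by rw [div_lt_iff₀ hxp]; nlinarith) hj
    (by rw [map_smul, hjx, smul_eq_mul, inv_mul_cancel₀ hxp.ne'])
  have e : ‖x‖⁻¹ • x + (‖h‖ / ‖x‖) • ‖h‖⁻¹ • h = ‖x‖⁻¹ • (x + h) := by
    rw [smul_smul, smul_add]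
    congr 2
    field_simp
  rw [e, norm_smul, norm_inv, norm_norm, map_smul, smul_eq_mul] at this
  have h2 := mul_le_mul_of_nonneg_left this hxp.le
  rw [mul_inv_cancel_left₀ hxp.ne'] at h2
  refine h2.trans (le_of_eq ?_)
  field_simp

theorem IsUniformlySmooth.norm_add_add_norm_sub_le {E : Type*} [NormedAddCommGroup E]
    [NormedSpace ℝ E] (hE : IsUniformlySmooth E) {ε : ℝ} (hε : 0 < ε) :
    ∃ δ > 0, ∀ x h : E, ‖h‖ ≤ δ * ‖x‖ → ‖x + h‖ + ‖x - h‖ ≤ 2 * ‖x‖ + ε * ‖h‖ := by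
  obtain ⟨δ, hδ, H⟩ := hE.norm_add_le (half_pos hε)
  refine ⟨δ, hδ, fun x h hh => ?_⟩
  obtain ⟨j, hj, hjx⟩ := exists_dual_vector'' ℝ x
  have a := H x h j hj (by simpa using hjx) hh
  have b := H x (-h) j hj (by simpa using hjx) (by simpa using hh)
  rw [← sub_eq_add_neg, map_neg, norm_neg] at b
  linarith

/-- The dual of a uniformly smooth space is uniformly convex. -/
theorem IsUniformlySmooth.dual_norm_add_le {E : Type*} [NormedAddCommGroup E] [NormedSpace ℝ E]
    (hE : IsUniformlySmooth E) {ε : ℝ} (hε : 0 < ε) :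
    ∃ δ > 0, δ < 1 ∧ ∀ φ ψ : E →L[ℝ] ℝ, ‖φ‖ ≤ 1 → ‖ψ‖ ≤ 1 → ε < ‖φ - ψ‖ →
      ‖φ + ψ‖ ≤ 2 * (1 - δ) := by
  obtain ⟨ρ, hρ, H⟩ := hE.norm_add_add_norm_sub_le (half_pos hε)
  -- The bound `1 / 4` forces `‖x‖ > 3 / 4`, so increments of norm `ρ / 2` are admissible in `H`;
  -- the other makes `2 * δ` at most `(ε / 2) * ‖h‖` for them.
  set δ : ℝ := min (1 / 4) (ε * ρ / 8) with hδdef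
  have hδ : 0 < δ := by positivity
  have hδ1 : δ ≤ 1 / 4 := min_le_left _ _
  have hδ2 : δ ≤ ε * ρ / 8 := min_le_right _ _
  refine ⟨δ, hδ, by linarith, fun φ ψ hφ hψ hne => ?_⟩
  by_contra! hlt
  obtain ⟨x, hx1, hx⟩ : ∃ x : E, ‖x‖ < 1 ∧ 2 * (1 - δ) < (φ + ψ) x := by
    obtain ⟨x, hx1, hx⟩ := ContinuousLinearMap.exists_lt_apply_of_lt_opNorm (φ + ψ) hlt
    rcases le_total 0 ((φ + ψ) x) with h | h
    · exact ⟨x, hx1, by rwa [Real.norm_of_nonneg h] at hx⟩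
    · exact ⟨-x, by simpa using hx1, by rwa [Real.norm_of_nonpos h, ← map_neg] at hx⟩
  have bd : ∀ (χ : E →L[ℝ] ℝ), ‖χ‖ ≤ 1 → ∀ y, χ y ≤ ‖y‖ := fun χ hχ y => by
    have := χ.le_of_opNorm_le hχ y
    rw [one_mul] at this
    exact (le_abs_self _).trans this
  rw [_root_.add_apply] at hx
  have hxl : 1 - δ < ‖x‖ := by linarith [bd φ hφ x, bd ψ hψ x]
  -- Here `(φ - ψ) h = φ (x + h) + ψ (x - h) - (φ + ψ) x`.
  have small : ∀ h : E, ‖h‖ = ρ / 2 → (φ - ψ) h ≤ ε * ‖h‖ := by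
    intro h hh
    have a := H x h (by rw [hh]; nlinarith)
    have b := bd φ hφ (x + h)
    have c := bd ψ hψ (x - h)
    rw [map_add] at b
    rw [map_sub] at c
    rw [_root_.sub_apply]
    rw [hh] at a ⊢
    nlinarith
  have all : ∀ h : E, (φ - ψ) h ≤ ε * ‖h‖ := by
    intro h
    rcases eq_or_ne h 0 with rfl | h0
    · simp
    have hp := norm_pos_iff.2 h0
    have hc : 0 < ρ / 2 / ‖h‖ := by positivity
    have := small ((ρ / 2 / ‖h‖) • h) (by
      rw [norm_smul, Real.norm_of_nonneg hc.le, div_mul_cancel₀ _ hp.ne'])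
    rw [map_smul, norm_smul, Real.norm_of_nonneg hc.le, smul_eq_mul, mul_left_comm] at this
    exact le_of_mul_le_mul_left this hc
  refine absurd (ContinuousLinearMap.opNorm_le_bound _ hε.le fun h => ?_) (not_le.2 hne)
  rw [Real.norm_eq_abs, abs_le]
  constructor
  · have := all (-h)
    rw [map_neg, norm_neg] at this
    linarith
  · exact all h

/-! ### Uniform normal structure -/

/-- Among sufficiently many vectors of the unit ball of a uniformly convex space there are two
successive blocks with convex combinations close to each other. -/
theorem exists_close_convex_blocks_or {X : Type*} [NormedAddCommGroup X] [NormedSpace ℝ X]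
    {ε δ : ℝ} (hδ1 : δ < 1)
    (hX : ∀ φ ψ : X, ‖φ‖ ≤ 1 → ‖ψ‖ ≤ 1 → ε < ‖φ - ψ‖ → ‖φ + ψ‖ ≤ 2 * (1 - δ)) (hε : 0 < ε)
    (hδ0 : 0 < δ) (g : ℕ → X) (hg : ∀ k, ‖g k‖ ≤ 1) (r : ℕ) : ∀ a : ℕ,
    (∃ b, ∃ φ ∈ convexHull ℝ (g '' Set.Ico a b), ∃ ψ ∈ convexHull ℝ (g '' Set.Ico b (a + 2 ^ r)),
      ‖φ - ψ‖ ≤ ε) ∨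
    ∃ φ ∈ convexHull ℝ (g '' Set.Ico a (a + 2 ^ r)), ‖φ‖ ≤ (1 - δ) ^ r := by
  induction r with
  | zero =>
    intro a
    exact .inr ⟨g a, subset_convexHull _ _ ⟨a, by simp, rfl⟩, by simpa using hg a⟩
  | succ r ih =>
    intro a
    have hpow : a + 2 ^ (r + 1) = a + 2 ^ r + 2 ^ r := by ring
    have hp2 : 0 < 2 ^ r := by positivity
    rw [hpow]
    rcases ih a with ⟨b, φ, hφ, ψ, hψ, hc⟩ | ⟨φ, hφ, hφn⟩
    · exact .inl ⟨b, φ, hφ, ψ, convexHull_mono (Set.image_mono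
        (Set.Ico_subset_Ico_right (by omega))) hψ, hc⟩
    rcases ih (a + 2 ^ r) with ⟨b, φ', hφ', ψ, hψ, hc⟩ | ⟨ψ, hψ, hψn⟩
    · exact .inl ⟨b, φ', convexHull_mono (Set.image_mono
        (Set.Ico_subset_Ico_left (by omega))) hφ', ψ, hψ, hc⟩
    by_cases hc : ‖φ - ψ‖ ≤ ε
    · exact .inl ⟨a + 2 ^ r, φ, hφ, ψ, hψ, hc⟩
    right
    push Not at hc
    have hφ' := convexHull_mono (Set.image_mono
        (Set.Ico_subset_Ico_right (by omega : a + 2 ^ r ≤ a + 2 ^ r + 2 ^ r))) hφ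
    have hψ' := convexHull_mono (Set.image_mono
        (Set.Ico_subset_Ico_left (by omega : a ≤ a + 2 ^ r))) hψ
    refine ⟨(1 / 2 : ℝ) • φ + (1 / 2 : ℝ) • ψ, convex_convexHull ℝ _ hφ' hψ' (by norm_num)
      (by norm_num) (by norm_num), ?_⟩
    -- Dividing by `s ≤ 1` returns both vectors to the unit ball and only increases their distance,
    -- so the midpoint gains another factor `1 - δ`.
    set s := (1 - δ) ^ r with hs
    have hs0 : 0 < s := pow_pos (by linarith) r
    have hs1 : s ≤ 1 := pow_le_one₀ (by linarith) (by linarith)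
    have nrm : ∀ v : X, ‖s⁻¹ • v‖ = s⁻¹ * ‖v‖ := fun v => by
      rw [norm_smul, norm_inv, Real.norm_of_nonneg hs0.le]
    have := hX (s⁻¹ • φ) (s⁻¹ • ψ) (by rw [nrm, inv_mul_le_iff₀ hs0]; linarith)
      (by rw [nrm, inv_mul_le_iff₀ hs0]; linarith)
      (by rw [← smul_sub, nrm, lt_inv_mul_iff₀ hs0]; nlinarith)
    rw [← smul_add, nrm, inv_mul_le_iff₀ hs0] at this
    rw [← smul_add, norm_smul, pow_succ, ← hs]
    norm_num
    linarith

/-- If neither of two adjacent blocks of length `2 ^ r` contains a close pair, each has a convex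
combination of norm below `ε / 2`, and these two are close. -/
theorem exists_close_convex_blocks {X : Type*} [NormedAddCommGroup X] [NormedSpace ℝ X]
    {ε δ : ℝ} (hε : 0 < ε) (hδ0 : 0 < δ) (hδ1 : δ < 1)
    (hX : ∀ φ ψ : X, ‖φ‖ ≤ 1 → ‖ψ‖ ≤ 1 → ε < ‖φ - ψ‖ → ‖φ + ψ‖ ≤ 2 * (1 - δ)) :
    ∃ N : ℕ, ∀ g : ℕ → X, (∀ k, ‖g k‖ ≤ 1) →
    ∃ b, ∃ φ ∈ convexHull ℝ (g '' Set.Ico 0 b), ∃ ψ ∈ convexHull ℝ (g '' Set.Ico b N),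
      ‖φ - ψ‖ ≤ ε := by
  obtain ⟨r, hr⟩ := exists_pow_lt_of_lt_one (half_pos hε) (by linarith : 1 - δ < 1)
  have hp2 : 0 < 2 ^ r := pow_pos two_pos r
  refine ⟨2 ^ r + 2 ^ r, fun g hg => ?_⟩
  rcases exists_close_convex_blocks_or hδ1 hX hε hδ0 g hg r 0 with
    ⟨b, φ, hφ, ψ, hψ, hc⟩ | ⟨φ, hφ, hφn⟩
  · exact ⟨b, φ, hφ, ψ, convexHull_mono (Set.image_mono
        (Set.Ico_subset_Ico_right (by omega))) hψ, hc⟩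
  rcases exists_close_convex_blocks_or hδ1 hX hε hδ0 g hg r (2 ^ r) with
    ⟨b, φ', hφ', ψ, hψ, hc⟩ | ⟨ψ, hψ, hψn⟩
  · exact ⟨b, φ', convexHull_mono (Set.image_mono
        (Set.Ico_subset_Ico_left (by omega))) hφ', ψ, hψ, hc⟩
  rw [zero_add] at hφ
  exact ⟨2 ^ r, φ, hφ, ψ, hψ, (norm_sub_le _ _).trans (by linarith)⟩

/-- Functionals with index above `2 * b` nearly vanish or are negative on `v = x (2 * b) - x 0`;
closeness of convex blocks passes this bound to some `F k` with `k < 2 * b`. Then `F k` and `F (2 *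
b)` make `‖u + t • v‖ + ‖u - t • v‖` too large for smoothness, where `u = x k - x (2 * b)`. -/
theorem IsUniformlySmooth.not_exists_diametral {E : Type*} [NormedAddCommGroup E]
    [NormedSpace ℝ E] (hE : IsUniformlySmooth E) :
    ∃ N : ℕ, ∃ η > 0, η < 1 ∧ ∀ (x : ℕ → E) (F : ℕ → E →L[ℝ] ℝ), (∀ k, ‖F k‖ ≤ 1) →
      (∀ i k, ‖x i - x k‖ ≤ 1) → ¬ ∀ k < N, ∀ i < k, 1 - η ≤ F k (x k - x i) := by
  obtain ⟨δ, hδ, H⟩ := hE.norm_add_add_norm_sub_le (ε := 1 / 4) (by norm_num)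
  set t : ℝ := min 1 (δ / 2) with htdef
  have ht : 0 < t := by positivity
  have ht1 : t ≤ 1 := min_le_left _ _
  have ht2 : t ≤ δ / 2 := min_le_right _ _
  have hε : 0 < t / 8 := by positivity
  obtain ⟨ρ, hρ, hρ1, hUC⟩ := hE.dual_norm_add_le hε
  obtain ⟨N, hN⟩ := exists_close_convex_blocks hε hρ hρ1 hUC
  refine ⟨2 * N, t / 8, hε, by linarith, fun x F hF hx hdi => ?_⟩
  have bd : ∀ k y, F k y ≤ ‖y‖ := fun k y => by
    have := (F k).le_of_opNorm_le (hF k) y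
    rw [one_mul] at this
    exact (le_abs_self _).trans this
  -- Only odd indices are used, so that `2 * b` separates the two blocks and every index exceeds
  -- `0`.
  obtain ⟨b, φ, hφ, ψ, hψ, hc⟩ := hN (fun k => F (2 * k + 1)) (fun k => hF _)
  have hb0 : 0 < b := by
    rcases convexHull_nonempty_iff.1 ⟨φ, hφ⟩ with ⟨_, k, hk, _⟩
    exact lt_of_le_of_lt (Nat.zero_le _) hk.2
  have hbN : b < N := by
    rcases convexHull_nonempty_iff.1 ⟨ψ, hψ⟩ with ⟨_, k, hk, _⟩
    exact lt_of_le_of_lt hk.1 hk.2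
  set v := x (2 * b) - x 0 with hv
  have hv1 : ‖v‖ ≤ 1 := hx _ _
  have hlin : IsLinearMap ℝ (fun χ : E →L[ℝ] ℝ => χ v) := ⟨fun _ _ => rfl, fun _ _ => rfl⟩
  have hψv : ψ v ≤ t / 8 := by
    refine convexHull_min ?_ (convex_halfSpace_le hlin (t / 8)) hψ
    rintro _ ⟨k, hk, rfl⟩
    obtain ⟨hk1, hk2⟩ := hk
    have e : v = (x (2 * k + 1) - x 0) - (x (2 * k + 1) - x (2 * b)) := by rw [hv]; abel
    have a1 := bd (2 * k + 1) (x (2 * k + 1) - x 0)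
    have a2 := hdi (2 * k + 1) (by omega) (2 * b) (by omega)
    change F (2 * k + 1) v ≤ t / 8
    rw [e, map_sub]
    linarith [hx (2 * k + 1) 0]
  have hφv : φ v ≤ t / 4 := by
    have := (φ - ψ).le_of_opNorm_le hc v
    have := (le_abs_self _).trans this
    rw [_root_.sub_apply] at this
    nlinarith
  obtain ⟨k, hkb, hk⟩ : ∃ k, k < 2 * b ∧ 0 < k ∧ F k v ≤ t / 4 := by
    by_contra! hcon
    have hsub : φ ∈ {χ : E →L[ℝ] ℝ | t / 4 < χ v} := by
      refine convexHull_min ?_ (convex_halfSpace_gt hlin (t / 4)) hφ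
      rintro _ ⟨k, hk, rfl⟩
      have := hk.2
      exact hcon (2 * k + 1) (by omega) (by omega)
    exact absurd hφv (not_le.2 hsub)
  set u := x k - x (2 * b) with hu
  have a1 := hdi k (by omega) 0 hk.1
  have a2 := hdi (2 * b) (by omega) k hkb
  have a3 := hdi (2 * b) (by omega) 0 (by omega)
  have hu1 : ‖u‖ ≤ 1 := hx _ _
  have hu2 : 1 - t / 8 ≤ ‖u‖ := by
    rw [hu, norm_sub_rev]
    exact a2.trans (bd _ _)
  have htv : ‖t • v‖ ≤ t := by
    rw [norm_smul, Real.norm_of_nonneg ht.le]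
    nlinarith
  have b1 := H u (t • v) (htv.trans (by nlinarith))
  have b2 := bd k (u + t • v)
  have b3 := bd (2 * b) (-(u - t • v))
  rw [norm_neg] at b3
  have e1 : u + t • v = (x k - x 0) - (1 - t) • v := by rw [hu, hv]; module
  have e2 : -(u - t • v) = (x (2 * b) - x k) + t • (x (2 * b) - x 0) := by rw [hu, hv]; module
  rw [e1, map_sub, map_smul, smul_eq_mul, ← e1] at b2
  rw [e2, map_add, map_smul, smul_eq_mul] at b3
  nlinarith [mul_le_mul_of_nonneg_left hk.2 (by linarith : 0 ≤ 1 - t),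
    mul_le_mul_of_nonneg_left a3 ht.le]

/-- A uniformly smooth space has uniform normal structure. -/
theorem IsUniformlySmooth.exists_center {E : Type*} [NormedAddCommGroup E]
    [NormedSpace ℝ E] (hE : IsUniformlySmooth E) :
    ∃ θ : ℝ, 0 < θ ∧ θ < 1 ∧ ∀ (C : Set E) (d : ℝ), C.Nonempty → Convex ℝ C →
      (∀ x ∈ C, ∀ y ∈ C, ‖x - y‖ ≤ d) → ∃ z ∈ C, ∀ x ∈ C, ‖x - z‖ ≤ θ * d := by
  obtain ⟨N, η, hη, hη1, H⟩ := hE.not_exists_diametral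
  -- `m k` gives `x i` the weight `2 ^ (i - k)`, so a defect `κ` at `m k` costs at most `2 ^ (k - i)
  -- * κ ≤ η` at `x i`.
  set κ : ℝ := η / 2 ^ N with hκ
  have h2N : (1 : ℝ) ≤ 2 ^ N := one_le_pow₀ (by norm_num)
  have hκ0 : 0 < κ := by positivity
  have hκη : κ ≤ η := div_le_self hη.le h2N
  refine ⟨1 - κ, by linarith, by linarith, fun C d hne hC hd => ?_⟩
  by_contra! hcon
  have hd0 : 0 < d := by
    obtain ⟨z, hz⟩ := hne
    obtain ⟨x, hx, hxz⟩ := hcon z hz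
    have := hd x hx z hz
    nlinarith [norm_nonneg (x - z)]
  choose! next hnext hfar using hcon
  obtain ⟨c, hc⟩ := hne
  let m : ℕ → E := fun n => Nat.rec c (fun _ z => (1 / 2 : ℝ) • z + (1 / 2 : ℝ) • next z) n
  have msucc : ∀ n, m (n + 1) = (1 / 2 : ℝ) • m n + (1 / 2 : ℝ) • next (m n) := fun n => rfl
  have hm : ∀ n, m n ∈ C := by
    intro n
    induction n with
    | zero => exact hc
    | succ n ih => exact hC ih (hnext _ ih) (by norm_num) (by norm_num) (by norm_num)
  set x : ℕ → E := fun n => next (m n) with hxdef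
  have hx : ∀ n, x n ∈ C := fun n => hnext _ (hm n)
  have hex : ∀ n, ∃ j : E →L[ℝ] ℝ, ‖j‖ ≤ 1 ∧ j (x n - m n) = ‖x n - m n‖ := fun n => by
    simpa using exists_dual_vector'' ℝ (x n - m n)
  choose F hF hFx using hex
  have bd : ∀ k, ∀ y ∈ C, F k (x k - y) ≤ d := fun k y hy => by
    have := (F k).le_of_opNorm_le (hF k) (x k - y)
    rw [one_mul] at this
    exact ((le_abs_self _).trans this).trans (hd _ (hx k) _ hy)
  have split : ∀ k i, F k (x k - m (i + 1)) = (F k (x k - m i) + F k (x k - x i)) / 2 := by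
    intro k i
    rw [msucc]
    simp only [map_sub, map_add, map_smul, smul_eq_mul, hxdef]
    ring
  have low : ∀ k j, j ≤ k → (1 - 2 ^ j * κ) * d ≤ F k (x k - m (k - j)) := by
    intro k j
    induction j with
    | zero =>
      intro _
      have := hfar _ (hm k)
      rw [Nat.sub_zero, hFx, pow_zero, one_mul]
      exact this.le
    | succ j ih =>
      intro hj
      have h1 := ih (by omega)
      have e : k - j = k - (j + 1) + 1 := by omega
      rw [e, split] at h1
      have := bd k _ (hx (k - (j + 1)))
      rw [pow_succ]
      linarith
  refine H (fun n => d⁻¹ • x n) F hF (fun i k => ?_) (fun k hk i hi => ?_)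
  · rw [← smul_sub, norm_smul, norm_inv, Real.norm_of_nonneg hd0.le, inv_mul_le_iff₀ hd0, mul_one]
    exact hd _ (hx i) _ (hx k)
  · have h1 := low k (k - (i + 1)) (by omega)
    have e : k - (k - (i + 1)) = i + 1 := by omega
    rw [e, split] at h1
    have h2 := bd k _ (hm i)
    have h3 : (2 : ℝ) ^ (k - (i + 1)) * 2 ≤ 2 ^ N := by
      rw [← pow_succ]
      exact pow_le_pow_right₀ (by norm_num) (by omega)
    have h4 : (2 : ℝ) ^ (k - (i + 1)) * 2 * κ ≤ η := by
      rw [hκ, mul_div_assoc', div_le_iff₀ (by positivity), mul_comm]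
      exact mul_le_mul_of_nonneg_left h3 hη.le
    rw [← smul_sub, map_smul, smul_eq_mul, le_inv_mul_iff₀ hd0]
    nlinarith

/-! ### Fixed points of nonexpansive maps -/

/-- Let `L` be the least closed convex invariant set containing `c`, and take the points of `L`
within `r` of all of `L`. For such `z`, the ball of radius `r` about `T z` contains `c` and `T ''
L`, hence `L` by minimality; so `T z` is again such a point. -/
theorem exists_invariant_subset_of_center {E : Type*} [NormedAddCommGroup E] [NormedSpace ℝ E]
    {T : E → E} {C : Set E} {r : ℝ} (hclosed : IsClosed C) (hconv : Convex ℝ C)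
    (hmaps : Set.MapsTo T C C) (hT : ∀ x ∈ C, ∀ y ∈ C, ‖T x - T y‖ ≤ ‖x - y‖)
    {c : E} (hc : c ∈ C) (hcr : ∀ x ∈ C, ‖x - c‖ ≤ r) :
    ∃ A ⊆ C, A.Nonempty ∧ IsClosed A ∧ Convex ℝ A ∧ Set.MapsTo T A A ∧
      ∀ x ∈ A, ∀ y ∈ A, ‖x - y‖ ≤ r := by
  let S : Set (Set E) := {Y | IsClosed Y ∧ Convex ℝ Y ∧ Set.MapsTo T Y Y ∧ c ∈ Y}
  set L := ⋂₀ S with hL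
  have hCS : C ∈ S := ⟨hclosed, hconv, hmaps, hc⟩
  have hLC : L ⊆ C := Set.sInter_subset_of_mem hCS
  have hLcl : IsClosed L := isClosed_sInter fun Y hY => hY.1
  have hLco : Convex ℝ L := convex_sInter fun Y hY => hY.2.1
  have hLT : Set.MapsTo T L L := fun x hx Y hY => hY.2.2.1 (hx Y hY)
  have hcL : c ∈ L := fun Y hY => hY.2.2.2
  have hmin : ∀ B, IsClosed B → Convex ℝ B → c ∈ B → (∀ x ∈ L, T x ∈ B) → L ⊆ B := by
    intro B hB1 hB2 hB3 hB4
    have : L ∩ B ∈ S := ⟨hLcl.inter hB1, hLco.inter hB2,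
      fun x hx => ⟨hLT hx.1, hB4 x hx.1⟩, hcL, hB3⟩
    exact (Set.sInter_subset_of_mem this).trans Set.inter_subset_right
  refine ⟨L ∩ ⋂ y ∈ L, Metric.closedBall y r, Set.inter_subset_left.trans hLC, ⟨c, hcL, ?_⟩,
    hLcl.inter (isClosed_biInter fun _ _ => Metric.isClosed_closedBall),
    hLco.inter (convex_iInter₂ fun _ _ => convex_closedBall _ _), ?_, ?_⟩
  · simp only [Set.mem_iInter, mem_closedBall_iff_norm]
    intro y hy
    rw [norm_sub_rev]
    exact hcr y (hLC hy)
  · rintro z ⟨hzL, hz⟩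
    simp only [Set.mem_iInter, mem_closedBall_iff_norm] at hz
    refine ⟨hLT hzL, ?_⟩
    have : L ⊆ Metric.closedBall (T z) r := by
      refine hmin _ Metric.isClosed_closedBall (convex_closedBall _ _) ?_ fun x hx => ?_
      · rw [mem_closedBall_iff_norm, norm_sub_rev]
        exact hcr _ (hLC (hLT hzL))
      · rw [mem_closedBall_iff_norm, norm_sub_rev]
        exact (hT z (hLC hzL) x (hLC hx)).trans (hz x hx)
    simp only [Set.mem_iInter]
    intro y hy
    exact Metric.mem_closedBall_comm.1 (this hy)
  · rintro x ⟨_, hx⟩ y ⟨hyL, _⟩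
    simp only [Set.mem_iInter, mem_closedBall_iff_norm] at hx
    exact hx y hyL

/-- A nonexpansive self-map of a bounded closed convex subset of a uniformly smooth Banach space
has a fixed point. -/
theorem IsUniformlySmooth.exists_fixedPoint {E : Type*} [NormedAddCommGroup E]
    [NormedSpace ℝ E] [CompleteSpace E] (hE : IsUniformlySmooth E) {T : E → E} {C : Set E} {d : ℝ}
    (hne : C.Nonempty) (hclosed : IsClosed C) (hconv : Convex ℝ C)
    (hmaps : Set.MapsTo T C C) (hT : ∀ x ∈ C, ∀ y ∈ C, ‖T x - T y‖ ≤ ‖x - y‖)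
    (hd : ∀ x ∈ C, ∀ y ∈ C, ‖x - y‖ ≤ d) : ∃ x ∈ C, T x = x := by
  obtain ⟨θ, hθ0, hθ1, hθ⟩ := hE.exists_center
  let S := {A : Set E // A ⊆ C ∧ A.Nonempty ∧ IsClosed A ∧ Convex ℝ A ∧ Set.MapsTo T A A}
  have step : ∀ A : S, ∃ B : S, B.1 ⊆ A.1 ∧ ∀ r, (∀ x ∈ A.1, ∀ y ∈ A.1, ‖x - y‖ ≤ r) →
      ∀ x ∈ B.1, ∀ y ∈ B.1, ‖x - y‖ ≤ θ * r := by
    rintro ⟨A, hAC, hA1, hA2, hA3, hA4⟩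
    have hbdd : Bornology.IsBounded A := Metric.isBounded_iff.2
      ⟨d, fun x hx y hy => by rw [dist_eq_norm]; exact hd x (hAC hx) y (hAC hy)⟩
    obtain ⟨c, hc, hcr⟩ := hθ A (Metric.diam A) hA1 hA3 fun x hx y hy => by
      rw [← dist_eq_norm]; exact Metric.dist_le_diam_of_mem hbdd hx hy
    obtain ⟨B, hBA, hB1, hB2, hB3, hB4, hB5⟩ := exists_invariant_subset_of_center hA2 hA3 hA4
      (fun x hx y hy => hT x (hAC hx) y (hAC hy)) hc hcr
    refine ⟨⟨B, hBA.trans hAC, hB1, hB2, hB3, hB4⟩, hBA, fun r hr x hx y hy => ?_⟩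
    refine (hB5 x hx y hy).trans (mul_le_mul_of_nonneg_left ?_ hθ0.le)
    refine Metric.diam_le_of_forall_dist_le ((norm_nonneg _).trans (hr c hc c hc)) ?_
    intro x hx y hy
    rw [dist_eq_norm]
    exact hr x hx y hy
  -- Iteration gives nested closed invariant sets of diameter at most `θ ^ n * d`; their common
  -- point and its image lie in all of them.
  choose next hsub hdiam using step
  let A : ℕ → S := fun n => Nat.rec ⟨C, subset_rfl, hne, hclosed, hconv, hmaps⟩ (fun _ => next) n
  have hA : ∀ n, ∀ x ∈ (A n).1, ∀ y ∈ (A n).1, ‖x - y‖ ≤ θ ^ n * d := by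
    intro n
    induction n with
    | zero =>
      rw [pow_zero, one_mul]
      exact hd
    | succ n ih =>
      rw [pow_succ', mul_assoc]
      exact hdiam (A n) _ ih
  have hanti : Antitone fun n => (A n).1 := antitone_nat_of_succ_le fun n => hsub (A n)
  have hlim : Tendsto (fun n => θ ^ n * d) atTop (𝓝 0) := by
    simpa using (tendsto_pow_atTop_nhds_zero_of_lt_one hθ0.le hθ1).mul_const d
  choose a ha using fun n => (A n).2.2.1
  have hcau : CauchySeq a := cauchySeq_of_le_tendsto_0 _ (fun n m N hn hm => by
    rw [dist_eq_norm]
    exact hA N _ (hanti hn (ha n)) _ (hanti hm (ha m))) hlim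
  obtain ⟨x, hx⟩ := cauchySeq_tendsto_of_complete hcau
  have hxA : ∀ n, x ∈ (A n).1 := fun n => (A n).2.2.2.1.mem_of_tendsto hx
    ((eventually_ge_atTop n).mono fun m hm => hanti hm (ha m))
  refine ⟨x, hxA 0, ?_⟩
  rw [← sub_eq_zero, ← norm_le_zero_iff]
  exact ge_of_tendsto' hlim fun n => hA n _ ((A n).2.2.2.2.2 (hxA n)) _ (hxA n)

/-! ### Convergence of the viscosity path -/

/-- The points of `D` whose asymptotic distance from `x s`, as `s → 0+`, is at most `c`. -/
def asymptoticBall {E : Type*} [NormedAddCommGroup E] (D : Set E) (x : ℝ → E) (c : ℝ) : Set E :=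
  {y | y ∈ D ∧ ∀ ε > 0, ∀ᶠ s in 𝓝[>] (0 : ℝ), ‖x s - y‖ ≤ c + ε}

theorem convex_asymptoticBall {E : Type*} [NormedAddCommGroup E] [NormedSpace ℝ E] {D : Set E}
    (hD : Convex ℝ D) (x : ℝ → E) (c : ℝ) : Convex ℝ (asymptoticBall D x c) := by
  intro y hy z hz a b ha hb hab
  refine ⟨hD hy.1 hz.1 ha hb hab, fun ε hε => ?_⟩
  filter_upwards [hy.2 ε hε, hz.2 ε hε] with s h1 h2
  rw [← mem_closedBall_iff_norm'] at h1 h2 ⊢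
  exact convex_closedBall _ _ h1 h2 ha hb hab

theorem isClosed_asymptoticBall {E : Type*} [NormedAddCommGroup E] {D : Set E}
    (hD : IsClosed D) (x : ℝ → E) (c : ℝ) : IsClosed (asymptoticBall D x c) := by
  refine isClosed_of_closure_subset fun y hy => ?_
  refine ⟨closure_minimal (fun z hz => hz.1) hD hy, fun ε hε => ?_⟩
  obtain ⟨z, hz, hyz⟩ := Metric.mem_closure_iff.1 hy (ε / 2) (half_pos hε)
  filter_upwards [hz.2 (ε / 2) (half_pos hε)] with s h1
  have := norm_sub_le_norm_sub_add_norm_sub (x s) z y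
  rw [dist_comm, dist_eq_norm] at hyz
  linarith

theorem norm_sub_le_of_mem_asymptoticBall {E : Type*} [NormedAddCommGroup E] {D : Set E}
    {x : ℝ → E} {c c' : ℝ} {y z : E} (hy : y ∈ asymptoticBall D x c)
    (hz : z ∈ asymptoticBall D x c') : ‖y - z‖ ≤ c + c' := by
  refine le_of_forall_pos_le_add fun ε hε => ?_
  obtain ⟨s, h1, h2⟩ := ((hy.2 (ε / 2) (half_pos hε)).and (hz.2 (ε / 2) (half_pos hε))).exists
  have := norm_sub_le_norm_sub_add_norm_sub y (x s) z
  rw [norm_sub_rev y (x s)] at this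
  linarith

theorem mapsTo_asymptoticBall {E : Type*} [NormedAddCommGroup E] {D : Set E} {T : E → E}
    (hTD : Set.MapsTo T D D) (hT : ∀ x ∈ D, ∀ y ∈ D, ‖T x - T y‖ ≤ ‖x - y‖) {x : ℝ → E}
    (hxD : ∀ᶠ s in 𝓝[>] (0 : ℝ), x s ∈ D)
    (hxT : Tendsto (fun s => ‖x s - T (x s)‖) (𝓝[>] (0 : ℝ)) (𝓝 0)) (c : ℝ) :
    Set.MapsTo T (asymptoticBall D x c) (asymptoticBall D x c) := by
  refine fun y hy => ⟨hTD hy.1, fun ε hε => ?_⟩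
  filter_upwards [hy.2 (ε / 2) (half_pos hε), hxD,
    hxT.eventually_lt_const (half_pos hε)] with s h1 h2 h3
  have := norm_sub_le_norm_sub_add_norm_sub (x s) (T (x s)) (T y)
  linarith [hT _ h2 _ hy.1]

/-- Under `j`, the `v` term contributes at most `(1 - s) * ‖x - q‖`; cancelling it leaves a factor
`s` on both sides, so the bound is free of `s`. -/
theorem norm_sub_le_of_viscosity_of_fixed {E : Type*} [NormedAddCommGroup E] [NormedSpace ℝ E]
    {s : ℝ} (hs : s ∈ Set.Ioo (0 : ℝ) 1) {x u v q : E} (hx : x = s • u + (1 - s) • v)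
    (hv : ‖v - q‖ ≤ ‖x - q‖) {j : E →L[ℝ] ℝ} (hj : ‖j‖ ≤ 1) (hjx : j (x - q) = ‖x - q‖) :
    ‖x - q‖ ≤ j (u - q) := by
  have e : x - q = s • (u - q) + (1 - s) • (v - q) := by rw [hx]; module
  have h1 : j (v - q) ≤ ‖v - q‖ := by
    have := j.le_of_opNorm_le hj (v - q)
    rw [one_mul] at this
    exact (le_abs_self _).trans this
  have h2 := congrArg j e
  rw [map_add, map_smul, map_smul, smul_eq_mul, smul_eq_mul, hjx] at h2
  have h3 := mul_le_mul_of_nonneg_left (h1.trans hv) (by linarith [hs.2] : 0 ≤ 1 - s)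
  have : s * ‖x - q‖ ≤ s * j (u - q) := by linarith
  exact le_of_mul_le_mul_left this hs.1

theorem IsUniformlySmooth.exists_tendsto_viscosity {E : Type*} [NormedAddCommGroup E]
    [NormedSpace ℝ E] [CompleteSpace E] (hE : IsUniformlySmooth E) {D : Set E}
    (hDclosed : IsClosed D) (hDconvex : Convex ℝ D) {T f : E → E} (hTD : Set.MapsTo T D D)
    (hfD : Set.MapsTo f D D) (hT : ∀ x ∈ D, ∀ y ∈ D, ‖T x - T y‖ ≤ ‖x - y‖) {α : ℝ}
    (hα0 : 0 < α) (hα1 : α < 1) (hf : ∀ x ∈ D, ∀ y ∈ D, ‖f x - f y‖ ≤ α * ‖x - y‖)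
    {p : E} (hpD : p ∈ D) (hp : T p = p) {x : ℝ → E}
    (hx : ∀ s ∈ Set.Ioo (0 : ℝ) 1, x s ∈ D ∧ x s = s • f (x s) + (1 - s) • T (x s)) :
    ∃ q ∈ D, T q = q ∧ Tendsto x (𝓝[>] (0 : ℝ)) (𝓝 q) := by
  set β := 1 - α with hβdef
  have hβ : 0 < β := by linarith
  have hIoo : ∀ᶠ s in 𝓝[>] (0 : ℝ), s ∈ Set.Ioo (0 : ℝ) 1 := Ioo_mem_nhdsGT one_pos
  have bd : ∀ (j : E →L[ℝ] ℝ), ‖j‖ ≤ 1 → ∀ y, j y ≤ ‖y‖ := fun j hj y => by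
    have := j.le_of_opNorm_le hj y
    rw [one_mul] at this
    exact (le_abs_self _).trans this
  have norming : ∀ q ∈ D, T q = q → ∀ s ∈ Set.Ioo (0 : ℝ) 1, ∃ j : E →L[ℝ] ℝ, ‖j‖ ≤ 1 ∧
      j (x s - q) = ‖x s - q‖ ∧ β * ‖x s - q‖ ≤ j (f q - q) := by
    intro q hq hTq s hs
    obtain ⟨j, hj, hjx⟩ := exists_dual_vector'' ℝ (x s - q)
    have hjx' : j (x s - q) = ‖x s - q‖ := by simpa using hjx
    have h1 := hT _ (hx s hs).1 _ hq
    rw [hTq] at h1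
    have h2 := norm_sub_le_of_viscosity_of_fixed hs (hx s hs).2 h1 hj hjx'
    have h3 := (bd j hj _).trans (hf _ (hx s hs).1 _ hq)
    have e : f (x s) - q = (f (x s) - f q) + (f q - q) := by abel
    rw [e, map_add] at h2
    exact ⟨j, hj, hjx', by linarith⟩
  set M := ‖f p - p‖ / β with hM
  have hM0 : 0 ≤ M := by positivity
  have hxp : ∀ s ∈ Set.Ioo (0 : ℝ) 1, ‖x s - p‖ ≤ M := by
    intro s hs
    obtain ⟨j, hj, -, h⟩ := norming p hpD hp s hs
    rw [hM, le_div_iff₀ hβ]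
    linarith [bd j hj (f p - p)]
  have hxT : Tendsto (fun s => ‖x s - T (x s)‖) (𝓝[>] (0 : ℝ)) (𝓝 0) := by
    have h0 : Tendsto (fun s : ℝ => s * (2 * M + ‖f p - p‖)) (𝓝[>] (0 : ℝ)) (𝓝 0) := by
      have : Tendsto (fun s : ℝ => s * (2 * M + ‖f p - p‖)) (𝓝 0) (𝓝 (0 * (2 * M + ‖f p - p‖))) :=
        tendsto_id.mul_const _
      rw [zero_mul] at this
      exact this.mono_left nhdsWithin_le_nhds
    refine squeeze_zero' (.of_forall fun _ => norm_nonneg _) (hIoo.mono fun s hs => ?_) h0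
    have e : x s - T (x s) = s • ((f (x s) - f p) + (f p - p) + (T p - T (x s))) := by
      have := (hx s hs).2
      rw [hp]
      calc x s - T (x s) = (s • f (x s) + (1 - s) • T (x s)) - T (x s) := by rw [← this]
        _ = _ := by module
    rw [e, norm_smul, Real.norm_of_nonneg hs.1.le]
    refine mul_le_mul_of_nonneg_left ?_ hs.1.le
    have h1 := hf _ (hx s hs).1 _ hpD
    have h2 := hT _ hpD _ (hx s hs).1
    have h3 := norm_add₃_le (a := f (x s) - f p) (b := f p - p) (c := T p - T (x s))
    rw [norm_sub_rev p] at h2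
    have h4 := hxp s hs
    nlinarith [norm_nonneg (x s - p)]
  set K := asymptoticBall D x with hK
  have hpK : p ∈ K M := ⟨hpD, fun ε hε => hIoo.mono fun s hs => by linarith [hxp s hs]⟩
  have hfix : ∀ c, (K c).Nonempty → ∃ q ∈ K c, T q = q := fun c hc =>
    hE.exists_fixedPoint hc (isClosed_asymptoticBall hDclosed x c)
      (convex_asymptoticBall hDconvex x c)
      (mapsTo_asymptoticBall hTD hT (hIoo.mono fun s hs => (hx s hs).1) hxT c)
      (fun y hy z hz => hT y hy.1 z hz.1)
      (fun y hy z hz => norm_sub_le_of_mem_asymptoticBall hy hz)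
  have improve : ∀ γ > 0, ∃ η > 0, (K (γ + η)).Nonempty → (K (γ - η)).Nonempty := by
    intro γ hγ
    -- `V` bounds `‖f q - q‖` for every `q` in `K (γ + η)` with `η ≤ 1`, so `τ` and `η` can be fixed
    -- before `q`.
    set V := 2 * (γ + 1 + M) + ‖f p - p‖ with hV
    have hV0 : 0 < V := by positivity
    set ε₁ := γ * β / (4 * V) with hε₁
    have hε₁0 : 0 < ε₁ := by positivity
    obtain ⟨δ, hδ, H⟩ := hE.norm_add_le hε₁0
    set τ := min 1 (min (γ / (4 * V)) (δ * γ / (2 * V))) with hτdef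
    have hτ0 : 0 < τ := by positivity
    have hτ1 : τ ≤ 1 := min_le_left _ _
    have hτ2 : τ * V ≤ γ / 4 := by
      have : τ ≤ γ / (4 * V) := (min_le_right _ _).trans (min_le_left _ _)
      rw [le_div_iff₀ (by positivity)] at this
      linarith
    have hτ3 : τ * V ≤ δ * (γ / 2) := by
      have : τ ≤ δ * γ / (2 * V) := (min_le_right _ _).trans (min_le_right _ _)
      rw [le_div_iff₀ (by positivity)] at this
      linarith
    set η := min 1 (γ * (τ * β) / 4) with hη
    have hη0 : 0 < η := by positivity
    have hη1 : η ≤ 1 := min_le_left _ _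
    have hη2 : η ≤ γ * (τ * β) / 4 := min_le_right _ _
    have hτβ : τ * β ≤ 1 := mul_le_one₀ hτ1 hβ.le (by linarith)
    have hτβ0 : 0 < τ * β := by positivity
    refine ⟨η, hη0, fun hne => ?_⟩
    obtain ⟨q, hq, hTq⟩ := hfix _ hne
    set v := f q - q with hv
    have hvV : ‖v‖ ≤ V := by
      have e : v = (f q - f p) + (f p - p) + (p - q) := by rw [hv]; abel
      have h1 := hf _ hq.1 _ hpD
      have h2 := norm_sub_le_of_mem_asymptoticBall hq hpK
      have h3 := norm_add₃_le (a := f q - f p) (b := f p - p) (c := p - q)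
      rw [← e, norm_sub_rev p q] at h3
      nlinarith [norm_nonneg (q - p)]
    have hτv : ‖-(τ • v)‖ ≤ τ * V := by
      rw [norm_neg, norm_smul, Real.norm_of_nonneg hτ0.le]
      exact mul_le_mul_of_nonneg_left hvV hτ0.le
    refine ⟨q + τ • v, ?_, fun ε hε => ?_⟩
    · have e : q + τ • v = (1 - τ) • q + τ • f q := by rw [hv]; module
      rw [e]
      exact hDconvex hq.1 (hfD hq.1) (by linarith) hτ0.le (by ring)
    filter_upwards [hq.2 ε hε, hIoo] with s hs1 hs
    obtain ⟨j, hj, hjx, hjv⟩ := norming q hq.1 hTq s hs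
    have e : x s - (q + τ • v) = (x s - q) + -(τ • v) := by abel
    rw [e]
    -- If `x s` is within `γ / 2` of `q`, the shift adds at most `γ / 4`. Otherwise smoothness gives
    -- `(1 - τ * β) * ‖x s - q‖ + γ * (τ * β) / 4`, and the gain outweighs `2 * η`.
    rcases lt_or_ge ‖x s - q‖ (γ / 2) with hlt | hge
    · have := _root_.norm_add_le (x s - q) (-(τ • v))
      nlinarith
    · have h1 := H (x s - q) (-(τ • v)) j hj hjx
        (hτv.trans (hτ3.trans (mul_le_mul_of_nonneg_left hge hδ.le)))
      rw [map_neg, map_smul, smul_eq_mul] at h1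
      have h2 := mul_le_mul_of_nonneg_left hτv hε₁0.le
      have h3 : ε₁ * (τ * V) = γ * (τ * β) / 4 := by
        rw [hε₁]
        field_simp
      have h4 := mul_le_mul_of_nonneg_left hjv hτ0.le
      have h5 := mul_le_mul_of_nonneg_right hs1 (by linarith : 0 ≤ 1 - τ * β)
      have h6 : 0 ≤ (η + ε) * (τ * β) := by positivity
      nlinarith
  have hsmall : ∀ c > 0, (K c).Nonempty := by
    set S := {c : ℝ | 0 ≤ c ∧ (K c).Nonempty} with hS
    have hSM : M ∈ S := ⟨hM0, p, hpK⟩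
    have hSb : BddBelow S := ⟨0, fun c hc => hc.1⟩
    have mono : ∀ c c', c ≤ c' → (K c).Nonempty → (K c').Nonempty := by
      rintro c c' hcc ⟨y, hy⟩
      exact ⟨y, hy.1, fun ε hε => (hy.2 ε hε).mono fun s hs => by linarith⟩
    have hnn : ∀ c, (K c).Nonempty → 0 ≤ c := by
      rintro c ⟨y, hy⟩
      have := norm_sub_le_of_mem_asymptoticBall hy hy
      linarith [norm_nonneg (y - y)]
    have hγ : sInf S = 0 := by
      by_contra hne
      have hpos : 0 < sInf S := lt_of_le_of_ne (Real.sInf_nonneg fun c hc => hc.1) (Ne.symm hne)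
      obtain ⟨η, hη, hstep⟩ := improve _ hpos
      obtain ⟨c, hc, hlt⟩ := exists_lt_of_csInf_lt ⟨M, hSM⟩ (by linarith : sInf S < sInf S + η)
      have h1 := hstep (mono _ _ hlt.le hc.2)
      have h2 := csInf_le hSb (show sInf S - η ∈ S from ⟨hnn _ h1, h1⟩)
      linarith
    intro c hc
    obtain ⟨c', hc', hlt⟩ := exists_lt_of_csInf_lt ⟨M, hSM⟩ (by rw [hγ]; exact hc : sInf S < c)
    exact mono _ _ hlt.le hc'.2
  have hcau : Cauchy (map x (𝓝[>] (0 : ℝ))) := by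
    rw [Metric.cauchy_iff]
    refine ⟨inferInstance, fun ε hε => ?_⟩
    obtain ⟨y, hy⟩ := hsmall (ε / 8) (by linarith)
    refine ⟨Metric.closedBall y (ε / 4), ?_, fun a ha b hb => ?_⟩
    · rw [mem_map]
      filter_upwards [hy.2 (ε / 8) (by linarith)] with s hs
      rw [Set.mem_preimage, mem_closedBall_iff_norm]
      linarith
    · have := dist_triangle_right a b y
      linarith [Metric.mem_closedBall.1 ha, Metric.mem_closedBall.1 hb]
  obtain ⟨q, hq⟩ := CompleteSpace.complete hcau
  have hqx : Tendsto x (𝓝[>] (0 : ℝ)) (𝓝 q) := hq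
  have hqD : q ∈ D := hDclosed.mem_of_tendsto hqx (hIoo.mono fun s hs => (hx s hs).1)
  refine ⟨q, hqD, ?_, hqx⟩
  have hxq : Tendsto (fun s => ‖x s - q‖) (𝓝[>] (0 : ℝ)) (𝓝 0) :=
    tendsto_iff_norm_sub_tendsto_zero.1 hqx
  have hsum : Tendsto (fun s => ‖x s - q‖ + ‖x s - T (x s)‖ + ‖x s - q‖) (𝓝[>] (0 : ℝ)) (𝓝 0) := by
    simpa using (hxq.add hxT).add hxq
  rw [← sub_eq_zero, ← norm_le_zero_iff]
  refine ge_of_tendsto hsum (hIoo.mono fun s hs => ?_)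
  have e : T q - q = (T q - T (x s)) + (T (x s) - x s) + (x s - q) := by abel
  have h3 := norm_add₃_le (a := T q - T (x s)) (b := T (x s) - x s) (c := x s - q)
  have h4 := hT _ hqD _ (hx s hs).1
  rw [← e, norm_sub_rev (T (x s))] at h3
  rw [norm_sub_rev q] at h4
  linarith

/-! ### Solvability, perturbation and conclusion -/

theorem IsNonexpansive.existsUnique_isViscositySolution {E : Type*} [NormedAddCommGroup E]
    [NormedSpace ℝ E] [CompleteSpace E] {D : Set E} (hDclosed : IsClosed D)
    (hDconvex : Convex ℝ D) (hne : D.Nonempty) {T f : D → D} (hT : IsNonexpansive T)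
    (hf : f ∈ contractionMaps D) {s : ℝ} (hs : s ∈ Set.Ioo (0 : ℝ) 1) :
    ∃! x : D, IsViscositySolution T f s x := by
  obtain ⟨α, hα0, hα1, hα⟩ := hf
  have : CompleteSpace D := hDclosed.completeSpace_coe
  have : Nonempty D := hne.to_subtype
  let S : D → D := fun x => ⟨s • (f x : E) + (1 - s) • (T x : E),
    hDconvex (f x).2 (T x).2 hs.1.le (by linarith [hs.2]) (by ring)⟩
  have hk0 : 0 ≤ s * α + (1 - s) := by nlinarith [hs.1, hs.2]
  have hk1 : s * α + (1 - s) < 1 := by nlinarith [hs.1, hs.2]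
  have hS : ContractingWith ⟨s * α + (1 - s), hk0⟩ S := by
    refine ⟨by exact_mod_cast hk1, LipschitzWith.of_dist_le_mul fun x y => ?_⟩
    rw [Subtype.dist_eq, Subtype.dist_eq, dist_eq_norm, dist_eq_norm]
    change ‖(s • (f x : E) + (1 - s) • (T x : E)) - (s • (f y : E) + (1 - s) • (T y : E))‖ ≤
      (s * α + (1 - s)) * ‖(x : E) - y‖
    have e : (s • (f x : E) + (1 - s) • (T x : E)) - (s • (f y : E) + (1 - s) • (T y : E)) =
      s • ((f x : E) - f y) + (1 - s) • ((T x : E) - T y) := by module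
    rw [e]
    refine (norm_add_le _ _).trans ?_
    rw [norm_smul, norm_smul, Real.norm_of_nonneg hs.1.le,
      Real.norm_of_nonneg (by linarith [hs.2] : 0 ≤ 1 - s)]
    have h1 := mul_le_mul_of_nonneg_left (hα x y) hs.1.le
    have h2 := mul_le_mul_of_nonneg_left (hT x y) (by linarith [hs.2] : 0 ≤ 1 - s)
    linarith
  have hiff : ∀ x, IsViscositySolution T f s x ↔ Function.IsFixedPt S x := fun x => by
    rw [Function.IsFixedPt, Subtype.ext_iff]
    exact eq_comm
  refine ⟨hS.fixedPoint S, (hiff _).2 hS.fixedPoint_isFixedPt, fun y hy => ?_⟩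
  exact hS.fixedPoint_unique ((hiff y).1 hy)

/-- Only `f` has to contract, so the contraction constants of the perturbations `f_n` may tend to
`1`. -/
theorem IsViscositySolution.norm_sub_le {E : Type*} [NormedAddCommGroup E] [NormedSpace ℝ E]
    {D : Set E} {T f g : D → D} (hT : IsNonexpansive T) {α : ℝ} (hα1 : α < 1)
    (hf : ∀ x y : D, ‖(f x : E) - f y‖ ≤ α * ‖(x : E) - y‖) {s : ℝ} (hs : s ∈ Set.Ioo (0 : ℝ) 1)
    {x z : D} (hx : IsViscositySolution T f s x) (hz : IsViscositySolution T g s z) :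
    ‖(z : E) - x‖ ≤ ‖(g z : E) - f z‖ / (1 - α) := by
  have e : (z : E) - x = s • (((g z : E) - f z) + ((f z : E) - f x)) +
      (1 - s) • ((T z : E) - T x) := by
    unfold IsViscositySolution at hx hz
    calc (z : E) - x = (s • (g z : E) + (1 - s) • (T z : E)) -
        (s • (f x : E) + (1 - s) • (T x : E)) := by rw [← hx, ← hz]
      _ = _ := by module
  have h1 := norm_add_le (s • (((g z : E) - f z) + ((f z : E) - f x)))
    ((1 - s) • ((T z : E) - T x))
  rw [← e, norm_smul, norm_smul, Real.norm_of_nonneg hs.1.le,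
    Real.norm_of_nonneg (by linarith [hs.2] : 0 ≤ 1 - s)] at h1
  have h2 := norm_add_le ((g z : E) - f z) ((f z : E) - f x)
  have h3 := mul_le_mul_of_nonneg_left (hT z x) (by linarith [hs.2] : 0 ≤ 1 - s)
  have h4 := mul_le_mul_of_nonneg_left (h2.trans (add_le_add_right (hf z x) _)) hs.1.le
  have h5 : s * ‖(z : E) - x‖ ≤ s * (‖(g z : E) - f z‖ + α * ‖(z : E) - x‖) := by linarith
  have h6 := le_of_mul_le_mul_left h5 hs.1
  rw [le_div_iff₀ (by linarith)]
  linarith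

theorem viscosityPath_spec {E : Type*} [NormedAddCommGroup E] [NormedSpace ℝ E] {D : Set E}
    {T f : D → D} {s : ℝ} (h : ∃ x : D, IsViscositySolution T f s x) :
    ∃ x : D, IsViscositySolution T f s x ∧ viscosityPath T f s = x :=
  ⟨h.choose, h.choose_spec, by rw [viscosityPath, dif_pos h]⟩

theorem lemma2p1 {E : Type*} [NormedAddCommGroup E] [NormedSpace ℝ E] [CompleteSpace E]
    (hE : IsUniformlySmooth E)
    (D : Set E) (hDclosed : IsClosed D) (hDconvex : Convex ℝ D)
    (T : D → D) (hT : IsNonexpansive T) (hfix : (Function.fixedPoints T).Nonempty)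
    (f : D → D) (hf : f ∈ contractionMaps D)
    (fs : ℕ → D → D) (hfs : ∀ n, fs n ∈ contractionMaps D)
    (hunif : TendstoUniformly fs f atTop)
    (t : ℕ → ℝ) (ht : ∀ n, t n ∈ Set.Ioo (0 : ℝ) 1) (ht0 : Tendsto t atTop (𝓝 0)) :
    -- the equations defining `x_t` and `z_n` are uniquely solvable
    (∀ s ∈ Set.Ioo (0 : ℝ) 1, ∃! x : D, IsViscositySolution T f s x) ∧
    (∀ n, ∃! x : D, IsViscositySolution T (fs n) (t n) x) ∧
    -- `Q(f)` is well defined, as a genuine limit, and is a fixed point of `T`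
    Tendsto (viscosityPath T f) (𝓝[>] (0 : ℝ)) (𝓝 (viscosityLimit T f)) ∧
    (∃ q : D, (q : E) = viscosityLimit T f ∧ T q = q) ∧
    -- `z_n → Q(f)` strongly
    ∀ z : ℕ → D, (∀ n, IsViscositySolution T (fs n) (t n) (z n)) →
      Tendsto (fun n => (z n : E)) atTop (𝓝 (viscosityLimit T f)) := by

  obtain ⟨p, hp⟩ := hfix
  have hne : D.Nonempty := ⟨p, p.2⟩
  have hex : ∀ s ∈ Set.Ioo (0 : ℝ) 1, ∃! x : D, IsViscositySolution T f s x := fun s hs =>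
    hT.existsUnique_isViscositySolution hDclosed hDconvex hne hf hs
  obtain ⟨α, hα0, hα1, hα⟩ := id hf
  classical
  -- Self-maps of `D` are extended by the identity; the values off `D` play no role.
  let ext : (D → D) → E → E := fun g x => if h : x ∈ D then g ⟨x, h⟩ else x
  have hext : ∀ (g : D → D) (x : D), ext g x = g x := fun g x => dif_pos x.2
  have hmaps : ∀ g, Set.MapsTo (ext g) D D := fun g x hx => by
    rw [hext g ⟨x, hx⟩]
    exact (g _).2
  obtain ⟨q, hqD, hTq, hlim⟩ := hE.exists_tendsto_viscosity hDclosed hDconvex (hmaps T) (hmaps f)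
    (fun x hx y hy => by
      rw [hext T ⟨x, hx⟩, hext T ⟨y, hy⟩]
      exact hT _ _) hα0 hα1
    (fun x hx y hy => by
      rw [hext f ⟨x, hx⟩, hext f ⟨y, hy⟩]
      exact hα _ _) p.2 (by rw [hext, show T p = p from hp]) (x := viscosityPath T f)
    (fun s hs => by
      obtain ⟨x, hx, he⟩ := viscosityPath_spec (hex s hs).exists
      rw [he, hext, hext]
      exact ⟨x.2, hx⟩)
  have hQ : viscosityLimit T f = q := hlim.limUnder_eq
  rw [hQ]
  refine ⟨hex, fun n => hT.existsUnique_isViscositySolution hDclosed hDconvex hne (hfs n) (ht n),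
    hlim, ⟨⟨q, hqD⟩, rfl, ?_⟩, fun z hz => ?_⟩
  · rw [Subtype.ext_iff, ← hext]
    exact hTq
  have ht0' : Tendsto t atTop (𝓝[>] 0) :=
    tendsto_nhdsWithin_iff.2 ⟨ht0, .of_forall fun n => (ht n).1⟩
  refine (hlim.comp ht0').congr_dist ?_
  rw [Metric.tendsto_nhds]
  intro ε hε
  have hβ : 0 < 1 - α := by linarith
  filter_upwards [Metric.tendstoUniformly_iff.1 hunif (ε * (1 - α)) (by positivity)] with n hn
  obtain ⟨x, hx, he⟩ := viscosityPath_spec (hex (t n) (ht n)).exists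
  have h1 := IsViscositySolution.norm_sub_le hT hα1 hα (ht n) hx (hz n)
  have h2 := hn (z n)
  rw [dist_comm, Subtype.dist_eq, dist_eq_norm] at h2
  rw [Real.dist_0_eq_abs, abs_of_nonneg dist_nonneg, dist_comm, Function.comp_apply, he,
    dist_eq_norm]
  exact h1.trans_lt ((div_lt_iff₀ hβ).2 h2)
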